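/- Setting. Let $n,r,\alpha$ be positive integers and let $P$ be an $n\times r$ real matrix with orthonormal columns ($P'P=I$). $\|\cdot\|$ is the induced $\ell_2$ norm, and for matrices $Q,P$ with orthonormal columns $\mathrm{SE}(Q,P):=\|(I-QQ')P\|$. For $T\subseteq\{1,\dots,n\}$, $I_T$ is the $n\times|T|$ matrix of the columns of the identity matrix indexed by $T$. Data. For $t=1,\dots,\alpha$ let $\ell_t=Pa_t$, where $a_1,\dots,a_\alpha$ are mutually independent, zero-mean, bounded random vectors in $\mathbb R^r$ with common diagonal covariance matrix $\Lambda=\mathrm{diag}(\lambda_1,\dots,\lambda_r)$, $\lambda_j>0$. Let $\lambda^-=\min_j\lambda_j$, $\lambda^+=\max_j\lambda_j$, $f=\lambda^+/\lambda^-$, and let $\eta$ be such that $(a_t)_j^2\le\eta\lambda_j$ almost surely for all $t,j$. Let $T_1,\dots,T_\alpha\subseteq\{1,\dots,n\}$ be (deterministic) sets and $q<1$. Assume one of the following. (PCA-missing) $y_t=\ell_t-I_{T_t}I_{T_t}'\ell_t$ and $\max_t\|I_{T_t}'P\|\le q<1$. (PCA-SDDC) $y_t=\ell_t+I_{T_t}M_{s,t}\ell_t$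 with (deterministic) $|T_t|\times n$ matrices $M_{s,t}$ and $\max_t\|M_{s,t}P\|\le q<1$. Support change model. Let $l$ be the number of times the set $T_t$ changes on $[1,\alpha]$, let $t^1<\dots<t^l$ be the times of change, $t^0=1$, $t^{l+1}=\alpha+1$, and let $T_t=T^{[k]}$ for $t\in[t^k,t^{k+1})$, $0\le k\le l$. For $k>l$ let $T^{[k]}$ be any continuation of the sequence (for instance $T^{[k]}=\emptyset$). Assume that, for some $s$, $\tilde\beta$ and some $\beta<\alpha$: 1. $t^{k+1}-t^k\le\tilde\beta$ and $|T^{[k]}|\le s$ for $0\le k\le l$; 2. $\rho^2\tilde\beta\le\beta$, where $\rho$ is the smallest positive integer such that $T^{[k]}$ and $T^{[k+\rho]}$ are disjoint for every $0\le k\le l$; 3. for $0\le k_1<k_2\le l$, the sets $T^{[k_1]}\setminus T^{[k_1+1]}$ and $T^{[k_2]}\setminus T^{[k_2+1]}$ are disjoint. Parameters. Let $\zeta>0$ with $r\zeta\le0.01$. Assume $$\alpha\ge\alpha_0:=\frac{32}{0.01^2}\,\eta^2\,\frac{11\,r^2\log n}{(r\zeta)^2}\,\max(f,qf,q^2f)^2,$$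 $$\frac{\beta}{\alpha}\le\Big(\frac{1-r\zeta}{2}\Big)^2\min\Big(\frac{(r\zeta)^2}{4.1\,(qf)^2},\ \frac{r\zeta}{q^2f}\Big)$$ (the right-hand side of the last inequality is $+\infty$ if $q=0$). Conclusion. Let $\hat P$ be the matrix whose columns are all the (orthonormal) eigenvectors of $\frac1\alpha\sum_{t=1}^\alpha y_ty_t'$ with eigenvalues above $0.95\,\lambda^-$. Then, with probability at least $1-6n^{-10}$, $\mathrm{SE}(\hat P,P)\le r\zeta$. -/

import Mathlib

open MeasureTheory ProbabilityTheory

-- From here on, the norm of a real matrix is the induced `l₂` (spectral) norm.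
open scoped Matrix Matrix.Norms.L2Operator

namespace CorrPCA

/-- A basis matrix: a (tall) matrix with orthonormal columns. -/
def IsBasisMatrix {n m : ℕ} (Q : Matrix (Fin n) (Fin m) ℝ) : Prop :=
  Qᵀ * Q = 1

/-- `I_T`: the columns of the `n × n` identity matrix indexed by the entries of `T`. -/
def idCols {n : ℕ} (T : Finset (Fin n)) : Matrix (Fin n) T ℝ :=
  (1 : Matrix (Fin n) (Fin n) ℝ).submatrix id Subtype.val

/-- The subspace error `SE(Q, P) = ‖(I - Q Q') P‖`. -/
noncomputable def subspaceError {n m r : ℕ}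
    (Q : Matrix (Fin n) (Fin m) ℝ) (P : Matrix (Fin n) (Fin r) ℝ) : ℝ :=
  ‖(1 - Q * Qᵀ) * P‖

/-- The empirical covariance matrix `(1/α) ∑_{t=1}^α y_t y_t'`. -/
noncomputable def empCov {n : ℕ} (α : ℕ) (y : ℕ → Fin n → ℝ) : Matrix (Fin n) (Fin n) ℝ :=
  (1 / (α : ℝ)) • ∑ t ∈ Finset.Icc 1 α, Matrix.vecMulVec (y t) (y t)

/-- `Q` is an output of simple EVD applied to the symmetric matrix `S` with threshold `τ`:
its columns are orthonormal, they are eigenvectors of `S` with eigenvalues above `τ`, and all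
the eigenvectors of `S` with eigenvalue above `τ` are accounted for. Such a `Q` is unique up to
the choice of an orthonormal basis of each eigenspace. -/
structure IsSimpleEVD {n m : ℕ} (S : Matrix (Fin n) (Fin n) ℝ) (τ : ℝ)
    (Q : Matrix (Fin n) (Fin m) ℝ) : Prop where
  basis : IsBasisMatrix Q
  eigen : ∀ i, ∃ κ : ℝ, τ < κ ∧ S *ᵥ Q.col i = κ • Q.col i
  all : ∀ (κ : ℝ) (v : Fin n → ℝ), τ < κ → S *ᵥ v = κ • v →
    v ∈ Submodule.span ℝ (Set.range Q.col)

/-- `λ⁻`, the smallest eigenvalue of the diagonal matrix with diagonal `lam`. -/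
noncomputable def lamMin {r : ℕ} (lam : Fin r → ℝ) : ℝ := ⨅ j, lam j

/-- `λ⁺`, the largest eigenvalue of the diagonal matrix with diagonal `lam`. -/
noncomputable def lamMax {r : ℕ} (lam : Fin r → ℝ) : ℝ := ⨆ j, lam j

/-- The condition number `f = λ⁺ / λ⁻`. -/
noncomputable def condNum {r : ℕ} (lam : Fin r → ℝ) : ℝ := lamMax lam / lamMin lam

/-- The assumptions on the subspace coefficients `a_t`, `t ∈ [1, α]`: mutually independent,
zero mean, with common positive definite diagonal covariance matrix `diag(lam)`, and bounded, with
`(a_t)_j ^ 2 ≤ η λ_j` almost surely. (The smallest `η` allowed here is the maximum over `j` and `t`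
of `(a_t)_j ^ 2 / λ_j`.) -/
structure CoeffModel {Ω : Type*} [MeasurableSpace Ω] (μ : Measure Ω) {r : ℕ} (α : ℕ)
    (a : ℕ → Ω → Fin r → ℝ) (lam : Fin r → ℝ) (η : ℝ) : Prop where
  measurable : ∀ t ∈ Finset.Icc 1 α, Measurable (a t)
  indep : iIndepFun (fun t : Finset.Icc 1 α => a t) μ
  mean_zero : ∀ t ∈ Finset.Icc 1 α, ∀ j, ∫ ω, a t ω j ∂μ = 0
  cov_eq : ∀ t ∈ Finset.Icc 1 α, ∀ i j,
    cov[fun ω => a t ω i, fun ω => a t ω j; μ] = Matrix.diagonal lam i j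
  lam_pos : ∀ j, 0 < lam j
  bounded : ∀ t ∈ Finset.Icc 1 α, ∀ j, ∀ᵐ ω ∂μ, (a t ω j) ^ 2 ≤ η * lam j

/-- The support change model for the sets `T_t`, `t ∈ [1, α]`. The set changes `l` times, at the
times `τ 1 < ⋯ < τ l`; with `τ 0 = 1` and `τ (l + 1) = α + 1`, it equals `S k` on
`[τ k, τ (k + 1))` for `0 ≤ k ≤ l`. The sets `S k` with `k > l`, which occur in `rho_least` and
`disjoint_motion`, may be any continuation of the sequence after time `α` (for instance `∅`). -/
structure SupportChange {n : ℕ} (α : ℕ) (T : ℕ → Finset (Fin n)) (l : ℕ) (τ : ℕ → ℕ)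
    (S : ℕ → Finset (Fin n)) (s ρ : ℕ) (βt β : ℝ) : Prop where
  tau_zero : τ 0 = 1
  tau_end : τ (l + 1) = α + 1
  tau_lt : ∀ k ≤ l, τ k < τ (k + 1)
  const : ∀ k ≤ l, ∀ t, τ k ≤ t → t < τ (k + 1) → T t = S k
  change : ∀ k < l, S k ≠ S (k + 1)
  moves_often : ∀ k ≤ l, (τ (k + 1) : ℝ) - (τ k : ℝ) ≤ βt
  card_le : ∀ k ≤ l, (S k).card ≤ s
  rho_least : IsLeast {p : ℕ | 0 < p ∧ ∀ k ≤ l, Disjoint (S k) (S (k + p))} ρ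
  moves_enough : (ρ : ℝ) ^ 2 * βt ≤ β
  disjoint_motion : ∀ k₁ k₂, k₁ < k₂ → k₂ ≤ l →
    Disjoint (S k₁ \ S (k₁ + 1)) (S k₂ \ S (k₂ + 1))
  beta_lt : β < α

/-- PCA with missing data: at each time `t ∈ [1, α]` the entries of `ℓ_t = P a_t` indexed by
`T_t` are set to zero, i.e. `y_t = ℓ_t - I_{T_t} I_{T_t}' ℓ_t`. -/
def IsPCAMissing {Ω : Type*} {n r : ℕ} (α : ℕ) (P : Matrix (Fin n) (Fin r) ℝ)
    (a : ℕ → Ω → Fin r → ℝ) (T : ℕ → Finset (Fin n)) (y : ℕ → Ω → Fin n → ℝ) : Prop :=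
  ∀ t ∈ Finset.Icc 1 α, ∀ ω,
    y t ω = P *ᵥ a t ω - idCols (T t) *ᵥ ((idCols (T t))ᵀ *ᵥ (P *ᵥ a t ω))

/-- PCA with sparse data-dependent corruptions: `y_t = ℓ_t + I_{T_t} M_{s,t} ℓ_t` with
`ℓ_t = P a_t`, for `t ∈ [1, α]`. -/
def IsPCASDDC {Ω : Type*} {n r : ℕ} (α : ℕ) (P : Matrix (Fin n) (Fin r) ℝ)
    (a : ℕ → Ω → Fin r → ℝ) (T : ℕ → Finset (Fin n))
    (Ms : (t : ℕ) → Matrix (T t) (Fin n) ℝ) (y : ℕ → Ω → Fin n → ℝ) : Prop :=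
  ∀ t ∈ Finset.Icc 1 α, ∀ ω,
    y t ω = P *ᵥ a t ω + idCols (T t) *ᵥ (Ms t *ᵥ (P *ᵥ a t ω))

/-- The sample complexity
`α₀ = C η² (11 r² log n / (rζ)²) max(f, q f, q² f)²` with `C = 32 / 0.01²`. -/
noncomputable def alphaZero (n r : ℕ) (η ζ q f : ℝ) : ℝ :=
  (32 / 0.01 ^ 2) * η ^ 2 * ((r : ℝ) ^ 2 * 11 * Real.log n / ((r : ℝ) * ζ) ^ 2) *
    (max (max f (q * f)) (q ^ 2 * f)) ^ 2

/-- The upper bound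
`((1 - rζ)/2)² min((rζ)² / (4.1 (q f)²), rζ / (q² f))` on `β / α` (meaningful for `q > 0`). -/
noncomputable def betaBound (r : ℕ) (ζ q f : ℝ) : ℝ :=
  ((1 - (r : ℝ) * ζ) / 2) ^ 2 *
    min (((r : ℝ) * ζ) ^ 2 / (4.1 * (q * f) ^ 2)) (((r : ℝ) * ζ) / (q ^ 2 * f))

end CorrPCA

/-! In both models `y_t = (P + B_t) a_t` with `B_t = I_{T_t} C_t` and `‖C_t‖ ≤ q`, so the empirical
covariance is `P Λ P' + H`, where `H` is a random fluctuation plus a deterministic bias.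

The fluctuation is a sum of independent bounded matrices. A dimension-free Hoeffding inequality in
the Frobenius norm (`measureReal_norm_sum_ge_le`) makes it at most `0.1 rζ λ⁻` outside an event of
probability `2 n⁻¹⁰`.

The bias is the time average of `P Λ B_t' + B_t Λ P' + B_t Λ B_t'`. Each index lies in `T_t` for at
most `β` times (`SupportChange.card_times_mem_le`), so `∑ ‖B_t' x‖² ≤ q² β ‖x‖²`. Cauchy–Schwarz in
time bounds the bias by `(2g + g²) λ⁺` with `g = q √(β/α)` (`norm_average_sub_le`), which is at most
`0.51 rζ λ⁻`.

Finally, a sin θ argument (`subspaceError_le`) turns `‖H‖ ≤ δ λ⁻` into a subspace error of at most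
`1.5 δ`, and `1.5 · 0.61 < 1`. No eigenvalue count is needed: eigenvalues below the threshold are
shown to be of order `‖H‖`. -/

namespace CorrPCA

open WithLp (toLp)

/-! ### Hoeffding's inequality in a Hilbert space. -/

section HilbertConcentration

/-- The series of `cosh w` in powers of `w ^ 2` has nonnegative coefficients, so `cosh` is convex as
a function of the square. -/
theorem cosh_le_of_sq_eq_add {p q u v w : ℝ} (hp : 0 ≤ p) (hq : 0 ≤ q) (hpq : p + q = 1)
    (h : w ^ 2 = p * u ^ 2 + q * v ^ 2) :
    Real.cosh w ≤ p * Real.cosh u + q * Real.cosh v := by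
  refine hasSum_le (fun k => ?_) (Real.hasSum_cosh w)
    (((Real.hasSum_cosh u).mul_left p).add ((Real.hasSum_cosh v).mul_left q))
  have hc := (convexOn_pow (𝕜 := ℝ) k).2 (Set.mem_Ici.2 (sq_nonneg u))
    (Set.mem_Ici.2 (sq_nonneg v)) hp hq hpq
  simp only [smul_eq_mul, ← h, ← pow_mul] at hc
  calc w ^ (2 * k) / ((2 * k).factorial : ℝ)
      ≤ (p * u ^ (2 * k) + q * v ^ (2 * k)) / ((2 * k).factorial : ℝ) := by gcongr
    _ = _ := by ring

theorem exp_sub_self_le_exp_sq {x : ℝ} (hx : 0 ≤ x) : Real.exp x - x ≤ Real.exp (x ^ 2) := by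
  rcases le_or_gt x 1 with h | h
  · have h1 := Real.norm_exp_sub_one_sub_id_le (x := x) (by rwa [Real.norm_eq_abs, abs_of_nonneg hx])
    rw [Real.norm_eq_abs, Real.norm_eq_abs, sq_abs] at h1
    have := Real.add_one_le_exp (x ^ 2)
    linarith [(abs_le.1 h1).2]
  · have : Real.exp x ≤ Real.exp (x ^ 2) := Real.exp_le_exp.2 (by nlinarith)
    linarith

theorem exp_sub_self_mono {x y : ℝ} (hx : 0 ≤ x) (hxy : x ≤ y) :
    Real.exp x - x ≤ Real.exp y - y := by
  have h1 := Real.add_one_le_exp (y - x)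
  have h2 : Real.exp y = Real.exp x * Real.exp (y - x) := by rw [← Real.exp_add]; ring_nf
  have h3 := Real.one_le_exp hx
  nlinarith

variable {E : Type*} [NormedAddCommGroup E] [InnerProductSpace ℝ E]

/-- `‖x + y‖ ^ 2` is affine in the cosine `s` of the angle, hence interpolates between `(c + d) ^ 2`
and `(c - d) ^ 2`, and convexity in the square applies. The error is arranged so that the direction
of `y` enters only through a linear term, which vanishes on averaging. -/
theorem cosh_norm_add_le (x y : E) :
    Real.cosh ‖x + y‖ ≤ Real.cosh ‖x‖ * (Real.exp ‖y‖ - ‖y‖) +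
      inner ℝ ((Real.sinh ‖x‖ / ‖x‖) • x) y := by
  have hE : ∀ d : ℝ, 0 ≤ d → Real.cosh d ≤ Real.exp d - d := fun d hd => by
    have := Real.self_le_sinh_iff.2 hd
    rw [← Real.cosh_add_sinh]; linarith
  rcases eq_or_ne x 0 with rfl | hx
  · simpa using hE _ (norm_nonneg y)
  rcases eq_or_ne y 0 with rfl | hy
  · simp
  have hc : 0 < ‖x‖ := norm_pos_iff.2 hx
  have hd : 0 < ‖y‖ := norm_pos_iff.2 hy
  have habs := abs_le.1 (abs_real_inner_le_norm x y)
  set c := ‖x‖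
  set d := ‖y‖
  set s := inner ℝ x y / (c * d) with hs
  have hcd : 0 < c * d := mul_pos hc hd
  have hs1 : s ≤ 1 := (div_le_one hcd).2 habs.2
  have hs2 : -1 ≤ s := (le_div_iff₀ hcd).2 (by linarith [habs.1])
  have hin : inner ℝ x y = s * (c * d) := by rw [hs]; field_simp
  have h1 : Real.cosh ‖x + y‖ ≤
      (1 + s) / 2 * Real.cosh (c + d) + (1 - s) / 2 * Real.cosh (c - d) := by
    refine cosh_le_of_sq_eq_add (by linarith) (by linarith) (by ring) ?_
    rw [norm_add_sq_real, hin]; ring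
  rw [Real.cosh_add, Real.cosh_sub] at h1
  rw [real_inner_smul_left, hin]
  have e : Real.sinh c / c * (s * (c * d)) = s * Real.sinh c * d := by field_simp
  rw [e, ← Real.cosh_add_sinh d]
  have h2 := Real.self_le_sinh_iff.2 hd.le
  have h3 : Real.sinh c ≤ Real.cosh c := (Real.sinh_lt_cosh c).le
  have h4 : 0 ≤ Real.sinh c := Real.sinh_nonneg_iff.2 hc.le
  -- This pays for replacing `sinh d` by `d` in the term carrying `s`: the cost is at most `cosh c *
  -- (sinh d - d)`.
  have h5 : s * Real.sinh c ≤ Real.cosh c := by nlinarith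
  nlinarith [mul_nonneg (sub_nonneg.2 h5) (sub_nonneg.2 h2)]

variable {Ω : Type*} [MeasurableSpace Ω] {μ : Measure Ω} [IsProbabilityMeasure μ]
  [MeasurableSpace E] [BorelSpace E] [SecondCountableTopology E] [CompleteSpace E]

/-- By independence the linear term integrates to the inner product with the mean of `X`, which is
zero. The bound `K` serves integrability only and does not enter the estimate. -/
theorem integral_cosh_norm_add_le {S X : Ω → E} {D K : ℝ} (hS : Measurable S) (hX : Measurable X)
    (hind : S ⟂ᵢ[μ] X) (hSK : ∀ᵐ ω ∂μ, ‖S ω‖ ≤ K) (hXD : ∀ᵐ ω ∂μ, ‖X ω‖ ≤ D)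
    (h0 : ∫ ω, X ω ∂μ = 0) :
    ∫ ω, Real.cosh ‖S ω + X ω‖ ∂μ ≤ (∫ ω, Real.cosh ‖S ω‖ ∂μ) * Real.exp (D ^ 2) := by
  have bdd : ∀ {Y : Ω → E} {C : ℝ}, Measurable Y → (∀ᵐ ω ∂μ, ‖Y ω‖ ≤ C) →
      Integrable (fun ω => Real.cosh ‖Y ω‖) μ := by
    intro Y C hY hC
    refine Integrable.of_bound (C := Real.cosh C)
      (Real.continuous_cosh.comp_stronglyMeasurable hY.norm.stronglyMeasurable).aestronglyMeasurable
      ?_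
    filter_upwards [hC] with ω hω
    rw [Real.norm_eq_abs, abs_of_pos (Real.cosh_pos _), Real.cosh_le_cosh, abs_norm]
    exact hω.trans (le_abs_self C)
  set G : E → E := fun x => (Real.sinh ‖x‖ / ‖x‖) • x with hG
  have hGm : Measurable G :=
    ((Real.continuous_sinh.measurable.comp measurable_norm).div measurable_norm).smul measurable_id
  have hGn : ∀ x, ‖G x‖ ≤ Real.cosh ‖x‖ := by
    intro x
    rcases eq_or_ne x 0 with rfl | hx
    · simp [hG]
    · have : 0 < ‖x‖ := norm_pos_iff.2 hx
      rw [hG, norm_smul, norm_div, norm_norm, div_mul_cancel₀ _ this.ne', Real.norm_eq_abs,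
        abs_of_nonneg (Real.sinh_nonneg_iff.2 this.le)]
      exact (Real.sinh_lt_cosh _).le
  have hintX : Integrable X μ := Integrable.of_bound hX.aestronglyMeasurable D hXD
  have hintG : Integrable (fun ω => G (S ω)) μ :=
    (bdd hS hSK).mono' (hGm.comp hS).aestronglyMeasurable (.of_forall fun ω => hGn _)
  have hindG : (fun ω => G (S ω)) ⟂ᵢ[μ] X := hind.comp hGm measurable_id
  have hint2 : Integrable (fun ω => inner ℝ (G (S ω)) (X ω)) μ :=
    hindG.integrable_bilin hintG hintX (innerSL ℝ)
  have hzero : ∫ ω, inner ℝ (G (S ω)) (X ω) ∂μ = 0 := by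
    have : ∫ ω, inner ℝ (G (S ω)) (X ω) ∂μ = inner ℝ (∫ ω, G (S ω) ∂μ) (∫ ω, X ω ∂μ) :=
      hindG.integral_bilin hintG hintX (innerSL ℝ (E := E))
    rw [this, h0, inner_zero_right]
  have hSX : ∀ᵐ ω ∂μ, ‖S ω + X ω‖ ≤ K + D := by
    filter_upwards [hSK, hXD] with ω h1 h2 using (norm_add_le _ _).trans (add_le_add h1 h2)
  calc ∫ ω, Real.cosh ‖S ω + X ω‖ ∂μ
      ≤ ∫ ω, (Real.cosh ‖S ω‖ * Real.exp (D ^ 2) + inner ℝ (G (S ω)) (X ω)) ∂μ := by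
        refine integral_mono_ae (bdd (hS.add hX) hSX) (((bdd hS hSK).mul_const _).add hint2) ?_
        filter_upwards [hXD] with ω h
        refine (cosh_norm_add_le _ _).trans ?_
        have h1 := (exp_sub_self_mono (norm_nonneg _) h).trans
          (exp_sub_self_le_exp_sq ((norm_nonneg _).trans h))
        have := (Real.cosh_pos ‖S ω‖).le
        simp only [hG]
        gcongr
    _ = _ := by
        rw [integral_add ((bdd hS hSK).mul_const _) hint2, hzero, add_zero, integral_mul_const]

theorem integral_cosh_norm_sum_le {ι : Type*} {X : ι → Ω → E} {D : ℝ}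
    (hX : ∀ i, Measurable (X i)) (hind : iIndepFun X μ) (hXD : ∀ i, ∀ᵐ ω ∂μ, ‖X i ω‖ ≤ D)
    (h0 : ∀ i, ∫ ω, X i ω ∂μ = 0) (s : Finset ι) :
    ∫ ω, Real.cosh ‖∑ i ∈ s, X i ω‖ ∂μ ≤ Real.exp (s.card * D ^ 2) := by
  classical
  induction s using Finset.induction_on with
  | empty => simp
  | insert i s hi ih =>
    have hbd : ∀ᵐ ω ∂μ, ‖∑ j ∈ s, X j ω‖ ≤ s.card * D := by
      filter_upwards [(Finset.eventually_all s).2 fun j _ => hXD j] with ω h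
      exact (norm_sum_le_of_le s h).trans (by simp)
    have hi' := hind.indepFun_finsetSum_of_notMem hX hi
    have key := integral_cosh_norm_add_le (S := fun ω => ∑ j ∈ s, X j ω) (X := X i)
      (Finset.measurable_fun_sum s fun j _ => hX j) (hX i)
      (by convert hi' using 1; ext ω; simp) hbd (hXD i) (h0 i)
    have e : ∀ ω, ∑ j ∈ insert i s, X j ω = ∑ j ∈ s, X j ω + X i ω := fun ω => by
      rw [Finset.sum_insert hi, add_comm]
    simp only [e]
    refine key.trans ((mul_le_mul_of_nonneg_right ih (Real.exp_pos _).le).trans ?_)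
    rw [← Real.exp_add, Finset.card_insert_of_notMem hi]
    apply le_of_eq
    congr 1
    push_cast
    ring

/-- A Hoeffding inequality for sums of independent bounded vectors of a Hilbert space. -/
theorem measureReal_norm_sum_ge_le {ι : Type*} [Fintype ι] {X : ι → Ω → E} {D u : ℝ}
    (hX : ∀ i, Measurable (X i)) (hind : iIndepFun X μ) (hXD : ∀ i, ∀ᵐ ω ∂μ, ‖X i ω‖ ≤ D)
    (h0 : ∀ i, ∫ ω, X i ω ∂μ = 0) (hD : 0 < D) (hu : 0 ≤ u) (hι : 0 < Fintype.card ι) :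
    μ.real {ω | u ≤ ‖∑ i, X i ω‖} ≤ 2 * Real.exp (-(u ^ 2 / (4 * Fintype.card ι * D ^ 2))) := by
  set N : ℝ := (Fintype.card ι : ℝ) with hN
  have hN0 : 0 < N := Nat.cast_pos.2 hι
  -- The minimiser of the Chernoff exponent `N * (c * D) ^ 2 - c * u`.
  set c : ℝ := u / (2 * N * D ^ 2) with hc
  have hc0 : 0 ≤ c := by positivity
  have h1 := integral_cosh_norm_sum_le (μ := μ) (X := fun i ω => c • X i ω) (D := c * D)
    (fun i => (hX i).const_smul c) (hind.comp (fun _ x => c • x) fun _ => measurable_const_smul c)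
    (fun i => by
      filter_upwards [hXD i] with ω h
      rw [norm_smul, Real.norm_eq_abs, abs_of_nonneg hc0]
      gcongr)
    (fun i => by rw [integral_smul, h0, smul_zero]) Finset.univ
  have hm : Measurable fun ω => ∑ i, c • X i ω :=
    Finset.measurable_fun_sum _ fun i _ => (hX i).const_smul c
  have hint : Integrable (fun ω => Real.cosh ‖∑ i, c • X i ω‖) μ := by
    refine Integrable.of_bound (C := Real.cosh (∑ _i : ι, c * D))
      (Real.continuous_cosh.comp_stronglyMeasurable hm.norm.stronglyMeasurable).aestronglyMeasurable
      ?_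
    filter_upwards [ae_all_iff.2 hXD] with ω h
    rw [Real.norm_eq_abs, abs_of_pos (Real.cosh_pos _), Real.cosh_le_cosh, abs_norm]
    refine (norm_sum_le_of_le _ fun i _ => ?_).trans (le_abs_self _)
    rw [norm_smul, Real.norm_eq_abs, abs_of_nonneg hc0]
    have := h i
    gcongr
  have h2 := mul_meas_ge_le_integral_of_nonneg (μ := μ)
    (.of_forall fun ω => (Real.cosh_pos ‖∑ i, c • X i ω‖).le) hint (Real.exp (c * u) / 2)
  have h3 : {ω | u ≤ ‖∑ i, X i ω‖} ⊆ {ω | Real.exp (c * u) / 2 ≤ Real.cosh ‖∑ i, c • X i ω‖} := by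
    intro ω hω
    have hω' : c * u ≤ ‖∑ i, c • X i ω‖ := by
      rw [← Finset.smul_sum, norm_smul, Real.norm_eq_abs, abs_of_nonneg hc0]
      exact mul_le_mul_of_nonneg_left hω hc0
    have h4 := Real.exp_le_exp.2 hω'
    have h5 := Real.exp_pos (-‖∑ i, c • X i ω‖)
    rw [Set.mem_ofPred_eq, Real.cosh_eq]
    linarith
  have h4 : μ.real {ω | u ≤ ‖∑ i, X i ω‖} ≤
      μ.real {ω | Real.exp (c * u) / 2 ≤ Real.cosh ‖∑ i, c • X i ω‖} := measureReal_mono h3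
  have h5 := (mul_le_mul_of_nonneg_left h4 (by positivity : 0 ≤ Real.exp (c * u) / 2)).trans
    (h2.trans h1)
  have h6 : -(u ^ 2 / (4 * N * D ^ 2)) = N * (c * D) ^ 2 - c * u := by
    rw [hc]; field_simp; ring
  rw [h6, Real.exp_sub, mul_div_assoc', le_div_iff₀ (Real.exp_pos _)]
  rw [Finset.card_univ, ← hN] at h5
  linarith

end HilbertConcentration

/-! ### Spectral norm bounds and a sin θ theorem. -/

section SubspacePerturbation

section EuclideanNorm
variable {m n : Type*} [Fintype m] [Fintype n]

theorem norm_toLp_mulVec_le [DecidableEq n] (A : Matrix m n ℝ) (v : n → ℝ) :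
    ‖toLp 2 (A *ᵥ v)‖ ≤ ‖A‖ * ‖toLp 2 v‖ :=
  A.l2_opNorm_mulVec (toLp 2 v)

theorem l2_opNorm_le_of_mulVec_le [DecidableEq n] {A : Matrix m n ℝ} {c : ℝ} (hc : 0 ≤ c)
    (h : ∀ v, ‖toLp 2 (A *ᵥ v)‖ ≤ c * ‖toLp 2 v‖) : ‖A‖ ≤ c := by
  rw [Matrix.l2_opNorm_def]
  exact ContinuousLinearMap.opNorm_le_bound _ hc fun v => h v.ofLp

theorem norm_toLp_sq (v : n → ℝ) : ‖toLp 2 v‖ ^ 2 = v ⬝ᵥ v := by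
  rw [EuclideanSpace.real_norm_sq_eq]
  simp [dotProduct, sq]

theorem abs_dotProduct_le (v w : n → ℝ) : |v ⬝ᵥ w| ≤ ‖toLp 2 v‖ * ‖toLp 2 w‖ := by
  have := abs_real_inner_le_norm (toLp 2 w) (toLp 2 v)
  rwa [EuclideanSpace.inner_toLp_toLp, star_trivial, mul_comm] at this

theorem l2_opNorm_le_of_dotProduct_le [DecidableEq n] {A : Matrix m n ℝ} {c : ℝ} (hc : 0 ≤ c)
    (h : ∀ x v, |x ⬝ᵥ A *ᵥ v| ≤ c * (‖toLp 2 x‖ * ‖toLp 2 v‖)) : ‖A‖ ≤ c := by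
  refine l2_opNorm_le_of_mulVec_le hc fun v => ?_
  have h1 := (le_abs_self _).trans (h (A *ᵥ v) v)
  rw [← norm_toLp_sq] at h1
  by_contra! hlt
  have h2 : 0 < ‖toLp 2 (A *ᵥ v)‖ := lt_of_le_of_lt (by positivity) hlt
  nlinarith

theorem l2_opNorm_transpose [DecidableEq m] [DecidableEq n] (A : Matrix m n ℝ) : ‖Aᵀ‖ = ‖A‖ := by
  rw [← Matrix.conjTranspose_eq_transpose_of_trivial, Matrix.l2_opNorm_conjTranspose]

theorem norm_toLp_le_of_abs_le {v w : n → ℝ} (h : ∀ i, |v i| ≤ |w i|) :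
    ‖toLp 2 v‖ ≤ ‖toLp 2 w‖ := by
  rw [← sq_le_sq₀ (norm_nonneg _) (norm_nonneg _), EuclideanSpace.real_norm_sq_eq,
    EuclideanSpace.real_norm_sq_eq]
  exact Finset.sum_le_sum fun i _ => sq_le_sq.2 (h i)

theorem norm_toLp_smul (c : ℝ) (v : n → ℝ) : ‖toLp 2 (c • v)‖ = |c| * ‖toLp 2 v‖ := by
  rw [WithLp.toLp_smul, norm_smul, Real.norm_eq_abs]

theorem norm_toLp_diagonal_mulVec_le [DecidableEq n] {d : n → ℝ} {c : ℝ} (hc : 0 ≤ c) (hd : ∀ i, |d i| ≤ c)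
    (v : n → ℝ) : ‖toLp 2 (Matrix.diagonal d *ᵥ v)‖ ≤ c * ‖toLp 2 v‖ := by
  rw [← abs_of_nonneg hc, ← norm_toLp_smul]
  refine norm_toLp_le_of_abs_le fun i => ?_
  rw [Matrix.mulVec_diagonal, abs_mul, Pi.smul_apply, smul_eq_mul, abs_mul, abs_of_nonneg hc]
  exact mul_le_mul_of_nonneg_right (hd i) (abs_nonneg _)

end EuclideanNorm

variable {n m r : ℕ}

theorem IsBasisMatrix.norm_toLp_mulVec {P : Matrix (Fin n) (Fin r) ℝ} (hP : IsBasisMatrix P)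
    (v : Fin r → ℝ) : ‖toLp 2 (P *ᵥ v)‖ = ‖toLp 2 v‖ := by
  rw [← sq_eq_sq₀ (norm_nonneg _) (norm_nonneg _), norm_toLp_sq, norm_toLp_sq,
    Matrix.dotProduct_mulVec, ← Matrix.mulVec_transpose, Matrix.mulVec_mulVec,
    (hP : Pᵀ * P = 1), Matrix.one_mulVec]

theorem IsBasisMatrix.opNorm_le_one {P : Matrix (Fin n) (Fin r) ℝ} (hP : IsBasisMatrix P) :
    ‖P‖ ≤ 1 :=
  l2_opNorm_le_of_mulVec_le zero_le_one fun v => by rw [hP.norm_toLp_mulVec, one_mul]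

section Perturbation

variable {S H : Matrix (Fin n) (Fin n) ℝ} {P : Matrix (Fin n) (Fin r) ℝ} {lam : Fin r → ℝ}
  {L δ : ℝ}

/-- An eigenvalue of `P Λ P' + H` below `0.95 L`, where `L` bounds `Λ` from below, is in fact
of the order of `H`. -/
theorem abs_eigenvalue_le (hP : IsBasisMatrix P) (hS : S = P * Matrix.diagonal lam * Pᵀ + H)
    (hL : 0 < L) (hlam : ∀ j, L ≤ lam j) (hδ : δ ≤ 1 / 100) (hH : ‖H‖ ≤ δ * L)
    {x : Fin n → ℝ} {κ : ℝ} (hx : ‖toLp 2 x‖ = 1) (hκ : S *ᵥ x = κ • x) (hκL : κ ≤ 0.95 * L) :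
    |κ| ≤ 5 / 4 * δ * L := by
  set p := Pᵀ *ᵥ x with hp
  set g := Pᵀ *ᵥ (H *ᵥ x) with hg
  have hHx : ‖toLp 2 (H *ᵥ x)‖ ≤ δ * L := by
    exact (norm_toLp_mulVec_le H x).trans (by rwa [hx, mul_one])
  have hgn : ‖toLp 2 g‖ ≤ δ * L := by
    refine (norm_toLp_mulVec_le _ _).trans ?_
    rw [l2_opNorm_transpose]
    calc ‖P‖ * ‖toLp 2 (H *ᵥ x)‖ ≤ 1 * ‖toLp 2 (H *ᵥ x)‖ :=
          mul_le_mul_of_nonneg_right hP.opNorm_le_one (norm_nonneg _)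
      _ ≤ δ * L := by rwa [one_mul]
  have hSx : S *ᵥ x = P *ᵥ (Matrix.diagonal lam *ᵥ p) + H *ᵥ x := by
    rw [hS, Matrix.add_mulVec, hp]; simp only [Matrix.mulVec_mulVec, Matrix.mul_assoc]
  have hPS : κ • p = Matrix.diagonal lam *ᵥ p + g := by
    have := congrArg (Pᵀ *ᵥ ·) (hκ.symm.trans hSx)
    simp only [Matrix.mulVec_smul, Matrix.mulVec_add] at this
    rwa [Matrix.mulVec_mulVec, (hP : Pᵀ * P = 1), Matrix.one_mulVec] at this
  -- Coordinatewise `(lam j - κ) * p j = -g j`, and the threshold leaves a gap `lam j - κ ≥ 0.05 *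
  -- L`.
  have hpn : 0.05 * L * ‖toLp 2 p‖ ≤ ‖toLp 2 g‖ := by
    rw [← abs_of_nonneg (by positivity : 0 ≤ 0.05 * L), ← norm_toLp_smul]
    refine norm_toLp_le_of_abs_le fun j => ?_
    have h1 := congrFun hPS j
    simp only [Pi.add_apply, Pi.smul_apply, smul_eq_mul, Matrix.mulVec_diagonal] at h1
    have h2 : g j = -((lam j - κ) * p j) := by linarith
    rw [h2, abs_neg, abs_mul, Pi.smul_apply, smul_eq_mul, abs_mul]
    refine mul_le_mul_of_nonneg_right ?_ (abs_nonneg _)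
    exact abs_le_abs_of_nonneg (by positivity) (by linarith [hlam j])
  have hp5 : ‖toLp 2 p‖ ≤ 1 / 5 := by nlinarith [norm_nonneg (toLp 2 p)]
  have hxx : x ⬝ᵥ x = 1 := by rw [← norm_toLp_sq, hx]; norm_num
  have hk : κ = p ⬝ᵥ (Matrix.diagonal lam *ᵥ p) + x ⬝ᵥ (H *ᵥ x) := by
    have := congrArg (x ⬝ᵥ ·) (hκ.symm.trans hSx)
    simp only [dotProduct_smul, dotProduct_add, hxx, smul_eq_mul, mul_one] at this
    rw [this, Matrix.dotProduct_mulVec, ← Matrix.mulVec_transpose]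
  -- The eigenvalue equation eliminates the quadratic form in `Λ`, so the bound on `κ` is free of
  -- the condition number.
  have hpp : p ⬝ᵥ (Matrix.diagonal lam *ᵥ p) = κ * ‖toLp 2 p‖ ^ 2 - p ⬝ᵥ g := by
    have := congrArg (p ⬝ᵥ ·) hPS
    simp only [dotProduct_smul, dotProduct_add, smul_eq_mul, ← norm_toLp_sq] at this
    linarith
  have b1 : |x ⬝ᵥ (H *ᵥ x)| ≤ δ * L := (abs_dotProduct_le _ _).trans (by rwa [hx, one_mul])
  have b2 := (abs_dotProduct_le p g).trans (mul_le_mul_of_nonneg_left hgn (norm_nonneg _))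
  set N := ‖toLp 2 p‖
  have hN : 0 ≤ N := norm_nonneg _
  have h3 : |κ| * (1 - N ^ 2) ≤ (1 + N) * (δ * L) := by
    have : κ * (1 - N ^ 2) = x ⬝ᵥ (H *ᵥ x) - p ⬝ᵥ g := by linarith
    rw [← abs_of_nonneg (by nlinarith : 0 ≤ 1 - N ^ 2), ← abs_mul, this]
    exact (abs_sub _ _).trans (by linarith)
  have h4 : |κ| * (1 - N) ≤ δ * L := by nlinarith
  nlinarith [abs_nonneg κ]

/-- A sin `θ` theorem for simple EVD. -/
theorem subspaceError_le (hP : IsBasisMatrix P) (hSs : S.IsHermitian)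
    (hS : S = P * Matrix.diagonal lam * Pᵀ + H)
    (hL : 0 < L) (hlam : ∀ j, L ≤ lam j) (hδ : δ ≤ 1 / 100) (hH : ‖H‖ ≤ δ * L)
    {Q : Matrix (Fin n) (Fin m) ℝ} (hQ : IsSimpleEVD S (0.95 * L) Q) :
    subspaceError Q P ≤ 3 / 2 * δ := by
  have hδ0 : 0 ≤ δ := nonneg_of_mul_nonneg_left ((norm_nonneg _).trans hH) hL
  set R : Matrix (Fin n) (Fin n) ℝ := 1 - Q * Qᵀ with hR
  have hRT : Rᵀ = R := by simp [hR, Matrix.transpose_sub, Matrix.transpose_mul]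
  set b := hSs.eigenvectorBasis
  set κ := hSs.eigenvalues
  have hb : ∀ i, S *ᵥ (b i).ofLp = κ i • (b i).ofLp := hSs.mulVec_eigenvectorBasis
  have hST : Sᵀ = S := by rw [← Matrix.conjTranspose_eq_transpose_of_trivial]; exact hSs
  -- `R` is the spectral projection of `S` onto eigenvalues at most `0.95 * L`: it kills the other
  -- eigenvectors by completeness of `Q`, and fixes these by orthogonality of distinct eigenspaces.
  have hRbig : ∀ i, 0.95 * L < κ i → R *ᵥ (b i).ofLp = 0 := by
    intro i hi
    have hmem := hQ.all _ _ hi (hb i)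
    rw [← Matrix.range_mulVecLin] at hmem
    obtain ⟨w, hw⟩ := hmem
    rw [← hw, Matrix.mulVecLin_apply, Matrix.mulVec_mulVec, hR, Matrix.sub_mul, Matrix.mul_assoc,
      (hQ.basis : Qᵀ * Q = 1), Matrix.one_mul, Matrix.mul_one, sub_self, Matrix.zero_mulVec]
  have hRsmall : ∀ i, κ i ≤ 0.95 * L → R *ᵥ (b i).ofLp = (b i).ofLp := by
    intro i hi
    have : Qᵀ *ᵥ (b i).ofLp = 0 := by
      ext j
      obtain ⟨c, hc, hcj⟩ := hQ.eigen j
      have h1 : Q.col j ⬝ᵥ (S *ᵥ (b i).ofLp) = (S *ᵥ Q.col j) ⬝ᵥ (b i).ofLp := by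
        rw [Matrix.dotProduct_mulVec, ← Matrix.mulVec_transpose, hST]
      rw [hb, hcj, dotProduct_smul, smul_dotProduct, smul_eq_mul, smul_eq_mul] at h1
      have h2 : (c - κ i) * (Q.col j ⬝ᵥ (b i).ofLp) = 0 := by linarith
      rcases mul_eq_zero.1 h2 with h3 | h3
      · linarith
      · exact h3
    rw [hR, Matrix.sub_mulVec, ← Matrix.mulVec_mulVec, this, Matrix.mulVec_zero, Matrix.one_mulVec,
      sub_zero]
  have hpars : ∀ v : Fin n → ℝ, ‖toLp 2 v‖ ^ 2 = ∑ i, ((b i).ofLp ⬝ᵥ v) ^ 2 := by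
    intro v
    rw [← b.sum_sq_norm_inner_right (toLp 2 v)]
    refine Finset.sum_congr rfl fun i _ => ?_
    rw [EuclideanSpace.inner_eq_star_dotProduct, Real.norm_eq_abs, sq_abs, star_trivial,
      dotProduct_comm]
  have hmove : ∀ (A : Matrix (Fin n) (Fin n) ℝ), Aᵀ = A → ∀ u v : Fin n → ℝ,
      u ⬝ᵥ (A *ᵥ v) = (A *ᵥ u) ⬝ᵥ v := by
    intro A hA u v
    rw [Matrix.dotProduct_mulVec, ← Matrix.mulVec_transpose, hA]
  have hRS : ∀ w, ‖toLp 2 (R *ᵥ (S *ᵥ w))‖ ≤ 5 / 4 * δ * L * ‖toLp 2 (R *ᵥ w)‖ := by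
    intro w
    rw [← sq_le_sq₀ (norm_nonneg _) (by positivity), mul_pow, hpars, hpars, Finset.mul_sum]
    refine Finset.sum_le_sum fun i _ => ?_
    rw [hmove R hRT, hmove R hRT]
    rcases lt_or_ge (0.95 * L) (κ i) with h | h
    · simp [hRbig i h]
    · rw [hRsmall i h, hmove S hST, hb, smul_dotProduct, smul_eq_mul, mul_pow]
      refine mul_le_mul_of_nonneg_right ?_ (sq_nonneg _)
      rw [← sq_abs]
      have := abs_eigenvalue_le hP hS hL hlam hδ hH (b.orthonormal.1 i) (hb i) h
      gcongr
  have hRn : ∀ v : Fin n → ℝ, ‖toLp 2 (R *ᵥ v)‖ ≤ ‖toLp 2 v‖ := by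
    intro v
    rw [← sq_le_sq₀ (norm_nonneg _) (norm_nonneg _), hpars, hpars]
    refine Finset.sum_le_sum fun i _ => ?_
    rw [hmove R hRT]
    rcases lt_or_ge (0.95 * L) (κ i) with h | h
    · simp [hRbig i h, sq_nonneg]
    · rw [hRsmall i h]
  -- With `z = Λ w`, `P z = S P w - H P w`. On the range of `R`, `S` has size at most `5/4 * δ * L`,
  -- so the error bounds itself with a small factor.
  have hkey : subspaceError Q P ≤ 5 / 4 * δ * subspaceError Q P + δ := by
    have hX0 : 0 ≤ subspaceError Q P := norm_nonneg _
    refine l2_opNorm_le_of_mulVec_le (by positivity) fun z => ?_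
    set w : Fin r → ℝ := Matrix.diagonal (fun j => (lam j)⁻¹) *ᵥ z with hw
    have hlam0 : ∀ j, 0 < lam j := fun j => hL.trans_le (hlam j)
    have hwn : ‖toLp 2 w‖ ≤ L⁻¹ * ‖toLp 2 z‖ := by
      refine norm_toLp_diagonal_mulVec_le (by positivity) (fun j => ?_) z
      rw [abs_of_pos (inv_pos.2 (hlam0 j))]
      exact inv_anti₀ hL (hlam j)
    have hz : Matrix.diagonal lam *ᵥ w = z := by
      rw [hw, Matrix.mulVec_mulVec, Matrix.diagonal_mul_diagonal]
      simp [(hlam0 _).ne']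
    have hSP : S *ᵥ (P *ᵥ w) = P *ᵥ z + H *ᵥ (P *ᵥ w) := by
      rw [hS, Matrix.add_mulVec]
      congr 1
      rw [Matrix.mulVec_mulVec, Matrix.mul_assoc _ Pᵀ P, (hP : Pᵀ * P = 1), Matrix.mul_one,
        ← Matrix.mulVec_mulVec, hz]
    have e : (R * P) *ᵥ z = R *ᵥ (S *ᵥ (P *ᵥ w)) - R *ᵥ (H *ᵥ (P *ᵥ w)) := by
      rw [hSP, Matrix.mulVec_add, add_sub_cancel_right, Matrix.mulVec_mulVec]
    rw [e, WithLp.toLp_sub]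
    have t1 : ‖toLp 2 (R *ᵥ (P *ᵥ w))‖ ≤ subspaceError Q P * ‖toLp 2 w‖ := by
      rw [Matrix.mulVec_mulVec]; exact norm_toLp_mulVec_le _ _
    have t2 : ‖toLp 2 (R *ᵥ (H *ᵥ (P *ᵥ w)))‖ ≤ δ * L * ‖toLp 2 w‖ := by
      refine (hRn _).trans ((norm_toLp_mulVec_le _ _).trans ?_)
      rw [hP.norm_toLp_mulVec]
      gcongr
    calc _ ≤ _ := norm_sub_le _ _
      _ ≤ 5 / 4 * δ * L * (subspaceError Q P * ‖toLp 2 w‖) + δ * L * ‖toLp 2 w‖ := by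
          refine add_le_add ((hRS _).trans ?_) t2
          gcongr
      _ = (5 / 4 * δ * subspaceError Q P + δ) * L * ‖toLp 2 w‖ := by ring
      _ ≤ (5 / 4 * δ * subspaceError Q P + δ) * L * (L⁻¹ * ‖toLp 2 z‖) := by gcongr
      _ = _ := by field_simp
  nlinarith [norm_nonneg (R * P), (rfl : subspaceError Q P = ‖R * P‖)]

end Perturbation

end SubspacePerturbation

/-! ### How often an index can be in the support. -/

section Support

variable {n α l s ρ : ℕ} {T S : ℕ → Finset (Fin n)} {τ : ℕ → ℕ} {βt β : ℝ}

/-- An index belongs to at most `ρ ^ 2` of the successive supports. -/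
theorem SupportChange.card_filter_mem_le (h : SupportChange α T l τ S s ρ βt β) (i : Fin n) :
    ((Finset.range (l + 1)).filter (fun k => i ∈ S k)).card ≤ ρ ^ 2 := by
  obtain ⟨⟨hρ, hdis⟩, -⟩ := h.rho_least
  have hnot : ∀ k ≤ l, i ∈ S k → i ∉ S (k + ρ) := fun k hk hi =>
    Finset.disjoint_left.1 (hdis k hk) hi
  -- An index leaves the support at most once, and an uninterrupted stay has length at most `ρ`.
  -- Hence there are at most two stays: one before the departure and one reaching the last support.
  have hleave : ∀ k₁ k₂, k₁ ≤ l → k₂ ≤ l → i ∈ S k₁ → i ∉ S (k₁ + 1) → i ∈ S k₂ →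
      i ∉ S (k₂ + 1) → k₁ = k₂ := by
    intro k₁ k₂ h1 h2 a1 b1 a2 b2
    rcases lt_trichotomy k₁ k₂ with hlt | rfl | hlt
    · exact absurd (Finset.mem_sdiff.2 ⟨a2, b2⟩)
        (Finset.disjoint_left.1 (h.disjoint_motion _ _ hlt h2) (Finset.mem_sdiff.2 ⟨a1, b1⟩))
    · rfl
    · exact absurd (Finset.mem_sdiff.2 ⟨a1, b1⟩)
        (Finset.disjoint_left.1 (h.disjoint_motion _ _ hlt h1) (Finset.mem_sdiff.2 ⟨a2, b2⟩))
  have hstay : ∀ k d, i ∈ S k → (∀ j, k ≤ j → j < k + d → i ∈ S j → i ∈ S (j + 1)) →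
      i ∈ S (k + d) := by
    intro k d hk hd
    induction d with
    | zero => exact hk
    | succ d ih =>
      exact hd (k + d) (by omega) (by omega) (ih fun j h1 h2 => hd j h1 (by omega))
  have hbound : ∀ k e, k ≤ e → e ≤ l → i ∈ S k →
      (∀ j, k ≤ j → j < e → i ∈ S j → i ∈ S (j + 1)) → e < k + ρ := by
    intro k e hke hel hk hst
    by_contra! hlt
    exact hnot k (hke.trans hel) hk (hstay k ρ hk fun j h1 h2 => hst j h1 (by omega))
  -- Two stays give `2 * ρ`, which exceeds `ρ ^ 2` when `ρ = 1`; in that case every membership is a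
  -- departure, so there is at most one.
  rcases (show ρ = 1 ∨ 2 ≤ ρ by omega) with rfl | hρ2
  · rw [one_pow, Finset.card_le_one]
    intro a ha b hb
    simp only [Finset.mem_filter, Finset.mem_range] at ha hb
    exact hleave a b (by omega) (by omega) ha.2 (hnot a (by omega) ha.2) hb.2
      (hnot b (by omega) hb.2)
  obtain ⟨e, he⟩ : ∃ e, ∀ j ≤ l, j ≠ e → i ∈ S j → i ∈ S (j + 1) := by
    by_cases hex : ∃ e ≤ l, i ∈ S e ∧ i ∉ S (e + 1)
    · obtain ⟨e, hel, he1, he2⟩ := hex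
      exact ⟨e, fun j hj hne hi => by_contra fun hc => hne (hleave j e hj hel hi hc he1 he2)⟩
    · push Not at hex
      -- No departure occurs, so any value of `e` would do.
      exact ⟨0, fun j hj _ hi => hex j hj hi⟩
  have hsub : (Finset.range (l + 1)).filter (fun k => i ∈ S k) ⊆
      Finset.Ico (e + 1 - ρ) (e + 1) ∪ Finset.Ico (l + 1 - ρ) (l + 1) := by
    intro k hk
    simp only [Finset.mem_filter, Finset.mem_range] at hk
    simp only [Finset.mem_union, Finset.mem_Ico]
    rcases le_or_gt k e with hke | hke
    · rcases le_or_gt e l with hel | hel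
      · have := hbound k e hke hel hk.2 fun j h1 h2 => he j (by omega) (by omega)
        omega
      · have := hbound k l (by omega) le_rfl hk.2 fun j h1 h2 => he j (by omega) (by omega)
        omega
    · have := hbound k l (by omega) le_rfl hk.2 fun j h1 h2 => he j (by omega) (by omega)
      omega
  refine (Finset.card_le_card hsub).trans ((Finset.card_union_le _ _).trans ?_)
  rw [Nat.card_Ico, Nat.card_Ico]
  have : 2 * ρ ≤ ρ ^ 2 := by nlinarith
  omega

/-- At most `ρ ^ 2` supports contain the index and each lasts at most `βt`. -/
theorem SupportChange.card_times_mem_le (h : SupportChange α T l τ S s ρ βt β) (i : Fin n) :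
    (((Finset.Icc 1 α).filter (fun t => i ∈ T t)).card : ℝ) ≤ β := by
  have hcover : (Finset.Icc 1 α).filter (fun t => i ∈ T t) ⊆
      ((Finset.range (l + 1)).filter (fun k => i ∈ S k)).biUnion
        (fun k => Finset.Ico (τ k) (τ (k + 1))) := by
    have hfind : ∀ k ≤ l, ∀ t, 1 ≤ t → t < τ (k + 1) → ∃ j ≤ k, τ j ≤ t ∧ t < τ (j + 1) := by
      intro k
      induction k with
      | zero => intro _ t h1 h2; exact ⟨0, le_rfl, by rw [h.tau_zero]; exact h1, h2⟩
      | succ k ih =>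
        intro hk t h1 h2
        rcases le_or_gt (τ (k + 1)) t with hle | hlt
        · exact ⟨k + 1, le_rfl, hle, h2⟩
        · obtain ⟨j, hj, hj'⟩ := ih (by omega) t h1 hlt
          exact ⟨j, by omega, hj'⟩
    intro t ht
    simp only [Finset.mem_filter, Finset.mem_Icc] at ht
    obtain ⟨j, hj, h1, h2⟩ := hfind l le_rfl t ht.1.1 (by rw [h.tau_end]; omega)
    simp only [Finset.mem_biUnion, Finset.mem_filter, Finset.mem_range, Finset.mem_Ico]
    exact ⟨j, ⟨by omega, by rw [← h.const j hj t h1 h2]; exact ht.2⟩, h1, h2⟩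
  have hβt : 0 ≤ βt := by
    refine le_trans ?_ (h.moves_often 0 (Nat.zero_le _))
    rw [sub_nonneg]
    exact_mod_cast (h.tau_lt 0 (Nat.zero_le _)).le
  calc (((Finset.Icc 1 α).filter (fun t => i ∈ T t)).card : ℝ)
      ≤ ((((Finset.range (l + 1)).filter (fun k => i ∈ S k)).biUnion
        (fun k => Finset.Ico (τ k) (τ (k + 1)))).card : ℝ) := by
        exact_mod_cast Finset.card_le_card hcover
    _ ≤ ∑ k ∈ (Finset.range (l + 1)).filter (fun k => i ∈ S k),
        ((Finset.Ico (τ k) (τ (k + 1))).card : ℝ) := by exact_mod_cast Finset.card_biUnion_le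
    _ ≤ ∑ k ∈ (Finset.range (l + 1)).filter (fun k => i ∈ S k), βt := by
        refine Finset.sum_le_sum fun k hk => ?_
        simp only [Finset.mem_filter, Finset.mem_range] at hk
        rw [Nat.card_Ico, Nat.cast_sub (h.tau_lt k (by omega)).le]
        exact h.moves_often k (by omega)
    _ = (((Finset.range (l + 1)).filter (fun k => i ∈ S k)).card : ℝ) * βt := by simp
    _ ≤ (ρ : ℝ) ^ 2 * βt := by
        refine mul_le_mul_of_nonneg_right ?_ hβt
        exact_mod_cast h.card_filter_mem_le i
    _ ≤ β := h.moves_enough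

end Support

/-! ### The bias caused by the sparse perturbations. -/

section SparseBias

variable {n r α : ℕ}

theorem norm_sq_idCols_transpose_mulVec (T : Finset (Fin n)) (x : Fin n → ℝ) :
    ‖toLp 2 ((idCols T)ᵀ *ᵥ x)‖ ^ 2 = ∑ i, if i ∈ T then x i ^ 2 else 0 := by
  have : ∀ i : T, ((idCols T)ᵀ *ᵥ x) i = x i := by
    intro i
    simp [idCols, Matrix.mulVec, dotProduct, Matrix.one_apply]
  rw [EuclideanSpace.real_norm_sq_eq]
  simp only [this]
  rw [Finset.sum_coe_sort T (fun i => x i ^ 2), Finset.sum_ite_mem, Finset.univ_inter]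

theorem norm_idCols_le_one (T : Finset (Fin n)) : ‖idCols T‖ ≤ 1 := by
  rw [← l2_opNorm_transpose]
  refine l2_opNorm_le_of_mulVec_le zero_le_one fun x => ?_
  rw [one_mul, ← sq_le_sq₀ (norm_nonneg _) (norm_nonneg _), norm_sq_idCols_transpose_mulVec,
    EuclideanSpace.real_norm_sq_eq]
  refine Finset.sum_le_sum fun i _ => ?_
  split_ifs
  · exact le_rfl
  · exact sq_nonneg _

theorem norm_idCols_mul_le {T : Finset (Fin n)} {C : Matrix T (Fin r) ℝ} {q : ℝ} (hC : ‖C‖ ≤ q) :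
    ‖idCols T * C‖ ≤ q := by
  refine (Matrix.l2_opNorm_mul _ _).trans ?_
  nlinarith [norm_idCols_le_one T, norm_nonneg C]

/-- If every index lies in few supports, then on average over time the row-sparse matrices
`I_{T_t} C_t` are small. -/
theorem sum_norm_sq_idCols_mul_le {T : ℕ → Finset (Fin n)} {C : (t : ℕ) → Matrix (T t) (Fin r) ℝ}
    {q β : ℝ} (hC : ∀ t ∈ Finset.Icc 1 α, ‖C t‖ ≤ q)
    (hT : ∀ i, (((Finset.Icc 1 α).filter (fun t => i ∈ T t)).card : ℝ) ≤ β) (x : Fin n → ℝ) :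
    ∑ t ∈ Finset.Icc 1 α, ‖toLp 2 ((idCols (T t) * C t)ᵀ *ᵥ x)‖ ^ 2 ≤
      q ^ 2 * β * ‖toLp 2 x‖ ^ 2 := by
  calc ∑ t ∈ Finset.Icc 1 α, ‖toLp 2 ((idCols (T t) * C t)ᵀ *ᵥ x)‖ ^ 2
      ≤ ∑ t ∈ Finset.Icc 1 α, q ^ 2 * ∑ i, if i ∈ T t then x i ^ 2 else 0 := by
        refine Finset.sum_le_sum fun t ht => ?_
        rw [Matrix.transpose_mul, ← Matrix.mulVec_mulVec, ← norm_sq_idCols_transpose_mulVec,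
          ← mul_pow]
        refine pow_le_pow_left₀ (norm_nonneg _) ((norm_toLp_mulVec_le _ _).trans ?_) 2
        rw [l2_opNorm_transpose]
        exact mul_le_mul_of_nonneg_right (hC t ht) (norm_nonneg _)
    _ = q ^ 2 * ∑ i, (((Finset.Icc 1 α).filter (fun t => i ∈ T t)).card : ℝ) * x i ^ 2 := by
        rw [← Finset.mul_sum, Finset.sum_comm]
        congr 1
        refine Finset.sum_congr rfl fun i _ => ?_
        rw [← Finset.sum_filter, Finset.sum_const, nsmul_eq_mul]
    _ ≤ q ^ 2 * ∑ i, β * x i ^ 2 := by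
        gcongr with i _
        exact hT i
    _ = _ := by rw [← Finset.mul_sum, EuclideanSpace.real_norm_sq_eq, mul_assoc]

/-- Cauchy–Schwarz over time turns the mean-square bound `hB` into a mean bound `g` for the two
terms linear in `B t`, and gives `g ^ 2` for the quadratic one. -/
theorem norm_average_sub_le {P : Matrix (Fin n) (Fin r) ℝ} (hP : IsBasisMatrix P)
    {B : ℕ → Matrix (Fin n) (Fin r) ℝ} {lam : Fin r → ℝ} {M g : ℝ} (hα : 0 < α) (hM : 0 ≤ M)
    (hlam : ∀ j, |lam j| ≤ M) (hg : 0 ≤ g)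
    (hB : ∀ x, ∑ t ∈ Finset.Icc 1 α, ‖toLp 2 ((B t)ᵀ *ᵥ x)‖ ^ 2 ≤ α * g ^ 2 * ‖toLp 2 x‖ ^ 2) :
    ‖(1 / (α : ℝ)) • ∑ t ∈ Finset.Icc 1 α, (P + B t) * Matrix.diagonal lam * (P + B t)ᵀ -
      P * Matrix.diagonal lam * Pᵀ‖ ≤ (2 * g + g ^ 2) * M := by
  have hα' : (0 : ℝ) < α := Nat.cast_pos.2 hα
  set Λ := Matrix.diagonal lam
  have e : (1 / (α : ℝ)) • ∑ t ∈ Finset.Icc 1 α, (P + B t) * Λ * (P + B t)ᵀ - P * Λ * Pᵀ =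
      (1 / (α : ℝ)) • ∑ t ∈ Finset.Icc 1 α, ((P + B t) * Λ * (P + B t)ᵀ - P * Λ * Pᵀ) := by
    rw [Finset.sum_sub_distrib, smul_sub, Finset.sum_const, Nat.card_Icc, Nat.add_sub_cancel,
      ← Nat.cast_smul_eq_nsmul ℝ, smul_smul, one_div, inv_mul_cancel₀ hα'.ne', one_smul]
  have hΛ : ∀ u v : Fin r → ℝ, |u ⬝ᵥ (Λ *ᵥ v)| ≤ M * (‖toLp 2 u‖ * ‖toLp 2 v‖) := by
    intro u v
    refine (abs_dotProduct_le _ _).trans ?_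
    have := mul_le_mul_of_nonneg_left (norm_toLp_diagonal_mulVec_le hM hlam v)
      (norm_nonneg (toLp 2 u))
    linarith
  have hPT : ∀ x : Fin n → ℝ, ‖toLp 2 (Pᵀ *ᵥ x)‖ ≤ ‖toLp 2 x‖ := by
    intro x
    refine (norm_toLp_mulVec_le _ _).trans ?_
    rw [l2_opNorm_transpose]
    exact mul_le_of_le_one_left (norm_nonneg _) hP.opNorm_le_one
  have hsum : ∀ x : Fin n → ℝ,
      ∑ t ∈ Finset.Icc 1 α, ‖toLp 2 ((B t)ᵀ *ᵥ x)‖ ≤ α * g * ‖toLp 2 x‖ := by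
    intro x
    have h1 := sq_sum_le_card_mul_sum_sq (s := Finset.Icc 1 α)
      (f := fun t => ‖toLp 2 ((B t)ᵀ *ᵥ x)‖)
    rw [Nat.card_Icc, Nat.add_sub_cancel] at h1
    refine (abs_le_of_sq_le_sq' ?_ (by positivity)).2
    refine h1.trans ((mul_le_mul_of_nonneg_left (hB x) hα'.le).trans (le_of_eq (by ring)))
  have hsum2 : ∀ x z : Fin n → ℝ,
      ∑ t ∈ Finset.Icc 1 α, ‖toLp 2 ((B t)ᵀ *ᵥ x)‖ * ‖toLp 2 ((B t)ᵀ *ᵥ z)‖ ≤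
        α * g ^ 2 * (‖toLp 2 x‖ * ‖toLp 2 z‖) := by
    intro x z
    have h1 := Finset.sum_mul_sq_le_sq_mul_sq (Finset.Icc 1 α)
      (fun t => ‖toLp 2 ((B t)ᵀ *ᵥ x)‖) (fun t => ‖toLp 2 ((B t)ᵀ *ᵥ z)‖)
    refine (abs_le_of_sq_le_sq' ?_ (by positivity)).2
    refine h1.trans ((mul_le_mul (hB x) (hB z) (Finset.sum_nonneg fun _ _ => sq_nonneg _)
      (by positivity)).trans (le_of_eq (by ring)))
  rw [e]
  refine l2_opNorm_le_of_dotProduct_le (by positivity) fun x z => ?_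
  rw [Matrix.smul_mulVec, dotProduct_smul, smul_eq_mul, abs_mul, abs_of_pos (by positivity),
    one_div, inv_mul_le_iff₀ hα', Matrix.sum_mulVec, dotProduct_sum]
  have hterm : ∀ t, x ⬝ᵥ (((P + B t) * Λ * (P + B t)ᵀ - P * Λ * Pᵀ) *ᵥ z) =
      (Pᵀ *ᵥ x) ⬝ᵥ (Λ *ᵥ ((B t)ᵀ *ᵥ z)) + ((B t)ᵀ *ᵥ x) ⬝ᵥ (Λ *ᵥ (Pᵀ *ᵥ z)) +
        ((B t)ᵀ *ᵥ x) ⬝ᵥ (Λ *ᵥ ((B t)ᵀ *ᵥ z)) := by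
    intro t
    have h1 : (P + B t) * Λ * (P + B t)ᵀ - P * Λ * Pᵀ =
        P * (Λ * (B t)ᵀ) + B t * (Λ * Pᵀ) + B t * (Λ * (B t)ᵀ) := by
      simp only [Matrix.transpose_add, Matrix.add_mul, Matrix.mul_add, Matrix.mul_assoc]
      abel
    rw [h1, Matrix.add_mulVec, Matrix.add_mulVec, dotProduct_add, dotProduct_add]
    simp only [← Matrix.mulVec_mulVec, Matrix.dotProduct_mulVec x, ← Matrix.mulVec_transpose]
  calc |∑ t ∈ Finset.Icc 1 α, x ⬝ᵥ (((P + B t) * Λ * (P + B t)ᵀ - P * Λ * Pᵀ) *ᵥ z)|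
      ≤ ∑ t ∈ Finset.Icc 1 α, M * (‖toLp 2 x‖ * ‖toLp 2 ((B t)ᵀ *ᵥ z)‖ +
          ‖toLp 2 ((B t)ᵀ *ᵥ x)‖ * ‖toLp 2 z‖ +
          ‖toLp 2 ((B t)ᵀ *ᵥ x)‖ * ‖toLp 2 ((B t)ᵀ *ᵥ z)‖) := by
        refine (Finset.abs_sum_le_sum_abs _ _).trans (Finset.sum_le_sum fun t _ => ?_)
        rw [hterm]
        refine (abs_add_three _ _ _).trans ?_
        rw [mul_add, mul_add]
        refine add_le_add_three ((hΛ _ _).trans ?_) ((hΛ _ _).trans ?_) (hΛ _ _)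
        · have := hPT x
          gcongr
        · have := hPT z
          gcongr
    _ = M * (‖toLp 2 x‖ * ∑ t ∈ Finset.Icc 1 α, ‖toLp 2 ((B t)ᵀ *ᵥ z)‖ +
          (∑ t ∈ Finset.Icc 1 α, ‖toLp 2 ((B t)ᵀ *ᵥ x)‖) * ‖toLp 2 z‖ +
          ∑ t ∈ Finset.Icc 1 α, ‖toLp 2 ((B t)ᵀ *ᵥ x)‖ * ‖toLp 2 ((B t)ᵀ *ᵥ z)‖) := by
        rw [← Finset.mul_sum, Finset.sum_add_distrib, Finset.sum_add_distrib, Finset.mul_sum,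
          Finset.sum_mul]
    _ ≤ M * (‖toLp 2 x‖ * (α * g * ‖toLp 2 z‖) + (α * g * ‖toLp 2 x‖) * ‖toLp 2 z‖ +
          α * g ^ 2 * (‖toLp 2 x‖ * ‖toLp 2 z‖)) := by
        gcongr
        · exact hsum z
        · exact hsum x
        · exact hsum2 x z
    _ = _ := by ring

end SparseBias

/-! ### Concentration of the empirical covariance. -/

section EmpiricalCovariance

/-- The entries of a matrix as a vector, so that the Euclidean norm is the Frobenius norm. -/
noncomputable def entryVec {n : ℕ} (A : Matrix (Fin n) (Fin n) ℝ) :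
    EuclideanSpace ℝ (Fin n × Fin n) :=
  toLp 2 fun p => A p.1 p.2

theorem norm_le_norm_entryVec {n : ℕ} (A : Matrix (Fin n) (Fin n) ℝ) : ‖A‖ ≤ ‖entryVec A‖ := by
  refine l2_opNorm_le_of_mulVec_le (norm_nonneg _) fun v => ?_
  rw [← sq_le_sq₀ (norm_nonneg _) (by positivity), mul_pow, EuclideanSpace.real_norm_sq_eq,
    EuclideanSpace.real_norm_sq_eq, EuclideanSpace.real_norm_sq_eq, entryVec,
    Fintype.sum_prod_type, Finset.sum_mul]
  exact Finset.sum_le_sum fun i _ =>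
    Finset.sum_mul_sq_le_sq_mul_sq Finset.univ (fun j => A i j) v

/-- For rank one matrices the Frobenius and spectral norms agree, so the Hilbert space inequality
loses nothing in the size of the summands. -/
theorem norm_entryVec_vecMulVec {n : ℕ} (v : Fin n → ℝ) :
    ‖entryVec (Matrix.vecMulVec v v)‖ = ‖toLp 2 v‖ ^ 2 := by
  rw [← sq_eq_sq₀ (norm_nonneg _) (by positivity), EuclideanSpace.real_norm_sq_eq,
    EuclideanSpace.real_norm_sq_eq, entryVec, Fintype.sum_prod_type, sq, Finset.sum_mul_sum]
  simp only [Matrix.vecMulVec_apply, mul_pow]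

theorem entryVec_smul_sum_sub {n α : ℕ} (c : ℝ) (A B : ℕ → Matrix (Fin n) (Fin n) ℝ) :
    entryVec (c • ∑ t ∈ Finset.Icc 1 α, A t - c • ∑ t ∈ Finset.Icc 1 α, B t) =
      c • ∑ t : Finset.Icc 1 α, (entryVec (A t) - entryVec (B t)) := by
  rw [Finset.sum_coe_sort (Finset.Icc 1 α) (fun t => entryVec (A t) - entryVec (B t)),
    ← smul_sub, ← Finset.sum_sub_distrib]
  ext p
  simp [entryVec, Matrix.sum_apply]

variable {Ω : Type*} [MeasurableSpace Ω] {μ : Measure Ω} {n r α : ℕ}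
  {a : ℕ → Ω → Fin r → ℝ} {lam : Fin r → ℝ} {η : ℝ}

theorem CoeffModel.measurable_apply (ha : CoeffModel μ α a lam η) {t : ℕ}
    (ht : t ∈ Finset.Icc 1 α) (j : Fin r) : Measurable fun ω => a t ω j :=
  (measurable_pi_apply j).comp (ha.measurable t ht)

theorem CoeffModel.integral_mul (ha : CoeffModel μ α a lam η) {t : ℕ}
    (ht : t ∈ Finset.Icc 1 α) (i j : Fin r) :
    ∫ ω, a t ω i * a t ω j ∂μ = Matrix.diagonal lam i j := by
  rw [← ha.cov_eq t ht i j, covariance, ha.mean_zero t ht, ha.mean_zero t ht]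
  simp

theorem CoeffModel.integrable_mul [IsProbabilityMeasure μ]
    (ha : CoeffModel μ α a lam η) {t : ℕ}
    (ht : t ∈ Finset.Icc 1 α) (i j : Fin r) :
    Integrable (fun ω => a t ω i * a t ω j) μ := by
  refine Integrable.of_bound (C := η * lam i + η * lam j)
    ((ha.measurable_apply ht i).mul (ha.measurable_apply ht j)).aestronglyMeasurable ?_
  filter_upwards [ha.bounded t ht i, ha.bounded t ht j] with ω h1 h2
  rw [Real.norm_eq_abs, abs_le]
  constructor <;> nlinarith [sq_nonneg (a t ω i + a t ω j), sq_nonneg (a t ω i - a t ω j)]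

/-- The mean of `(a_t)_j ^ 2` is `λ_j`, which cannot exceed the almost sure bound `η λ_j`. -/
theorem CoeffModel.one_le_eta [IsProbabilityMeasure μ]
    (ha : CoeffModel μ α a lam η) (hα : 0 < α) (hr : 0 < r) :
    1 ≤ η := by
  have ht : 1 ∈ Finset.Icc 1 α := Finset.mem_Icc.2 ⟨le_rfl, hα⟩
  set j : Fin r := ⟨0, hr⟩
  have h1 := ha.integral_mul ht j j
  rw [Matrix.diagonal_apply_eq] at h1
  have h2 : ∫ ω, a 1 ω j * a 1 ω j ∂μ ≤ ∫ _, η * lam j ∂μ := by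
    refine integral_mono_ae (ha.integrable_mul ht j j) (integrable_const _) ?_
    filter_upwards [ha.bounded 1 ht j] with ω h
    simpa [sq] using h
  rw [h1, integral_const, probReal_univ, one_smul] at h2
  exact le_of_mul_le_mul_right (by linarith) (ha.lam_pos j)

theorem CoeffModel.norm_sq_le (ha : CoeffModel μ α a lam η) {M : ℝ} (hη : 0 ≤ η)
    (hM : ∀ j, lam j ≤ M) {t : ℕ} (ht : t ∈ Finset.Icc 1 α) :
    ∀ᵐ ω ∂μ, ‖toLp 2 (a t ω)‖ ^ 2 ≤ r * η * M := by
  filter_upwards [ae_all_iff.2 (ha.bounded t ht)] with ω h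
  rw [EuclideanSpace.real_norm_sq_eq]
  calc ∑ j, (a t ω j) ^ 2 ≤ ∑ _j : Fin r, η * M :=
        Finset.sum_le_sum fun j _ => (h j).trans (mul_le_mul_of_nonneg_left (hM j) hη)
    _ = _ := by simp [mul_assoc]

theorem CoeffModel.integral_entryVec [IsProbabilityMeasure μ]
    (ha : CoeffModel μ α a lam η) {t : ℕ}
    (ht : t ∈ Finset.Icc 1 α) (N : Matrix (Fin n) (Fin r) ℝ)
    (hint : Integrable (fun ω => entryVec (Matrix.vecMulVec (N *ᵥ a t ω) (N *ᵥ a t ω))) μ) :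
    ∫ ω, entryVec (Matrix.vecMulVec (N *ᵥ a t ω) (N *ᵥ a t ω)) ∂μ =
      entryVec (N * Matrix.diagonal lam * Nᵀ) := by
  ext p
  have h1 : ∫ ω, (entryVec (Matrix.vecMulVec (N *ᵥ a t ω) (N *ᵥ a t ω))).ofLp p ∂μ =
      (∫ ω, entryVec (Matrix.vecMulVec (N *ᵥ a t ω) (N *ᵥ a t ω)) ∂μ).ofLp p :=
    (EuclideanSpace.proj p : EuclideanSpace ℝ (Fin n × Fin n) →L[ℝ] ℝ).integral_comp_comm hint
  rw [← h1]
  have h2 : ∀ ω, (entryVec (Matrix.vecMulVec (N *ᵥ a t ω) (N *ᵥ a t ω))).ofLp p =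
      ∑ i, ∑ j, N p.1 i * N p.2 j * (a t ω i * a t ω j) := by
    intro ω
    simp only [entryVec, Matrix.vecMulVec_apply, Matrix.mulVec, dotProduct]
    rw [Finset.sum_mul_sum]
    exact Finset.sum_congr rfl fun i _ => Finset.sum_congr rfl fun j _ => by ring
  simp only [h2]
  rw [integral_finsetSum _ fun i _ => integrable_finsetSum _ fun j _ =>
    (ha.integrable_mul ht i j).const_mul _]
  have h3 : (entryVec (N * Matrix.diagonal lam * Nᵀ)).ofLp p =
      ∑ i, N p.1 i * lam i * N p.2 i := by
    simp [entryVec, Matrix.mul_apply (M := N * Matrix.diagonal lam)]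
  rw [h3]
  refine Finset.sum_congr rfl fun i _ => ?_
  rw [integral_finsetSum _ fun j _ => (ha.integrable_mul ht i j).const_mul _]
  simp only [integral_const_mul, ha.integral_mul ht]
  simp [Matrix.diagonal_apply]
  ring

/-- Concentration of the empirical covariance of `y_t = N_t a_t` around its mean. -/
theorem CoeffModel.measureReal_norm_empCov_sub_ge_le [IsProbabilityMeasure μ]
    (ha : CoeffModel μ α a lam η) (hα : 0 < α)
    (hr : 0 < r) {M : ℝ} (hM : ∀ j, lam j ≤ M) {N : ℕ → Matrix (Fin n) (Fin r) ℝ}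
    (hN : ∀ t ∈ Finset.Icc 1 α, ‖N t‖ ≤ 2) {y : ℕ → Ω → Fin n → ℝ}
    (hy : ∀ t ∈ Finset.Icc 1 α, ∀ ω, y t ω = N t *ᵥ a t ω) {ε : ℝ} (hε : 0 ≤ ε) :
    μ.real {ω | ε ≤ ‖empCov α (fun t => y t ω) -
        (1 / (α : ℝ)) • ∑ t ∈ Finset.Icc 1 α, N t * Matrix.diagonal lam * (N t)ᵀ‖} ≤
      2 * Real.exp (-(α * ε ^ 2 / (256 * (r * η * M) ^ 2))) := by
  have hα' : (0 : ℝ) < α := Nat.cast_pos.2 hα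
  have hr' : (0 : ℝ) < r := Nat.cast_pos.2 hr
  have hη : 0 < η := zero_lt_one.trans_le (ha.one_le_eta hα hr)
  have hM0 : 0 < M := (ha.lam_pos ⟨0, hr⟩).trans_le (hM _)
  set W : Finset.Icc 1 α → Ω → EuclideanSpace ℝ (Fin n × Fin n) := fun t ω =>
    entryVec (Matrix.vecMulVec (N t *ᵥ a t ω) (N t *ᵥ a t ω)) with hW
  have hcont : ∀ A : Matrix (Fin n) (Fin r) ℝ,
      Measurable fun v : Fin r → ℝ => entryVec (Matrix.vecMulVec (A *ᵥ v) (A *ᵥ v)) := by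
    intro A
    refine Continuous.measurable ?_
    refine (PiLp.continuous_toLp 2 _).comp (continuous_pi fun p => ?_)
    simp only [Matrix.vecMulVec_apply, Matrix.mulVec, dotProduct]
    fun_prop
  have hWm : ∀ t, Measurable (W t) := fun t => (hcont (N t)).comp (ha.measurable t t.2)
  have hWb : ∀ t, ∀ᵐ ω ∂μ, ‖W t ω‖ ≤ 4 * (r * η * M) := by
    intro t
    filter_upwards [ha.norm_sq_le hη.le hM t.2] with ω h
    rw [hW, norm_entryVec_vecMulVec]
    have h1 : ‖toLp 2 (N t *ᵥ a t ω)‖ ≤ 2 * ‖toLp 2 (a t ω)‖ :=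
      (norm_toLp_mulVec_le _ _).trans
        (mul_le_mul_of_nonneg_right (hN t t.2) (norm_nonneg _))
    nlinarith [norm_nonneg (toLp 2 (N t *ᵥ a t ω)), norm_nonneg (toLp 2 (a t ω))]
  have hWint : ∀ t, Integrable (W t) μ := fun t =>
    Integrable.of_bound (hWm t).aestronglyMeasurable _ (hWb t)
  set E : Finset.Icc 1 α → EuclideanSpace ℝ (Fin n × Fin n) := fun t =>
    entryVec (N t * Matrix.diagonal lam * (N t)ᵀ) with hE
  have hEW : ∀ t, ∫ ω, W t ω ∂μ = E t := fun t => ha.integral_entryVec t.2 (N t) (hWint t)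
  have hEb : ∀ t, ‖E t‖ ≤ 4 * (r * η * M) := by
    intro t
    rw [← hEW]
    simpa using norm_integral_le_of_norm_le_const (hWb t)
  -- Centring doubles the bound `4 * (r * η * M)`; the constant 256 of the statement is `4 * 8 ^ 2`.
  have key := measureReal_norm_sum_ge_le (μ := μ) (X := fun t ω => W t ω - E t)
    (D := 8 * (r * η * M)) (u := α * ε) (fun t => (hWm t).sub_const _)
    (ha.indep.comp (fun t v => entryVec (Matrix.vecMulVec (N t *ᵥ v) (N t *ᵥ v)) - E t)
      fun t => (hcont (N t)).sub_const _)
    (fun t => by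
      filter_upwards [hWb t] with ω h
      exact (norm_sub_le _ _).trans (by linarith [hEb t]))
    (fun t => by
      rw [integral_sub (hWint t) (integrable_const _), hEW, integral_const, probReal_univ,
        one_smul, sub_self])
    (by positivity) (by positivity) (by simpa using hα)
  refine le_trans (measureReal_mono fun ω hω => ?_) (key.trans (le_of_eq ?_))
  · have h1 := le_trans (Set.mem_ofPred_eq ▸ hω) (norm_le_norm_entryVec _)
    have h2 : empCov α (fun t => y t ω) = (1 / (α : ℝ)) • ∑ t ∈ Finset.Icc 1 α,
        Matrix.vecMulVec (N t *ᵥ a t ω) (N t *ᵥ a t ω) := by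
      rw [empCov]
      congr 1
      exact Finset.sum_congr rfl fun t ht => by rw [hy t ht]
    rw [h2, entryVec_smul_sum_sub, norm_smul, Real.norm_eq_abs, abs_of_pos (by positivity),
      one_div, le_inv_mul_iff₀ hα'] at h1
    exact h1
  · simp only [Fintype.card_coe, Nat.card_Icc, Nat.add_sub_cancel]
    congr 3
    field_simp
    ring

end EmpiricalCovariance

/-! ### Extreme eigenvalues and condition number. -/

section CondNum

variable {r : ℕ} {lam : Fin r → ℝ}

theorem lamMin_le (j : Fin r) : lamMin lam ≤ lam j := ciInf_le (Set.finite_range _).bddBelow j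

theorem le_lamMax (j : Fin r) : lam j ≤ lamMax lam := le_ciSup (Set.finite_range _).bddAbove j

theorem lamMin_pos (hr : 0 < r) (h : ∀ j, 0 < lam j) : 0 < lamMin lam := by
  have : Nonempty (Fin r) := ⟨⟨0, hr⟩⟩
  obtain ⟨j, hj⟩ := exists_eq_ciInf_of_finite (f := lam)
  rw [lamMin, ← hj]
  exact h j

theorem one_le_condNum (hr : 0 < r) (h : ∀ j, 0 < lam j) : 1 ≤ condNum lam :=
  (one_le_div (lamMin_pos hr h)).2 ((lamMin_le ⟨0, hr⟩).trans (le_lamMax _))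

theorem lamMax_eq (hr : 0 < r) (h : ∀ j, 0 < lam j) : lamMax lam = condNum lam * lamMin lam :=
  (div_mul_cancel₀ _ (lamMin_pos hr h).ne').symm

end CondNum

/-! ### Reduction to one model, numerical consequences of the parameters, and conclusion. -/

theorem isHermitian_empCov {n : ℕ} (α : ℕ) (y : ℕ → Fin n → ℝ) : (empCov α y).IsHermitian := by
  rw [Matrix.IsHermitian, Matrix.conjTranspose_eq_transpose_of_trivial, empCov,
    Matrix.transpose_smul, Matrix.transpose_sum]
  simp only [Matrix.transpose_vecMulVec]

/-- Missing data and sparse data-dependent corruptions are both of the form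
`y_t = (P + I_{T_t} C_t) a_t` with `‖C_t‖ ≤ q`. -/
theorem exists_sparse_perturbation {Ω : Type*} {n r α : ℕ} {P : Matrix (Fin n) (Fin r) ℝ}
    {a : ℕ → Ω → Fin r → ℝ} {T : ℕ → Finset (Fin n)} {y : ℕ → Ω → Fin n → ℝ} {q : ℝ}
    (h : (IsPCAMissing α P a T y ∧ ∀ t ∈ Finset.Icc 1 α, ‖(idCols (T t))ᵀ * P‖ ≤ q) ∨
      (∃ Ms : (t : ℕ) → Matrix (T t) (Fin n) ℝ, IsPCASDDC α P a T Ms y ∧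
        ∀ t ∈ Finset.Icc 1 α, ‖Ms t * P‖ ≤ q)) :
    ∃ C : (t : ℕ) → Matrix (T t) (Fin r) ℝ, (∀ t ∈ Finset.Icc 1 α, ‖C t‖ ≤ q) ∧
      ∀ t ∈ Finset.Icc 1 α, ∀ ω, y t ω = (P + idCols (T t) * C t) *ᵥ a t ω := by
  rcases h with ⟨hy, hq⟩ | ⟨Ms, hy, hq⟩
  · refine ⟨fun t => -((idCols (T t))ᵀ * P), fun t ht => by rw [norm_neg]; exact hq t ht,
      fun t ht ω => ?_⟩
    rw [hy t ht ω, Matrix.add_mulVec, Matrix.mul_neg, Matrix.neg_mulVec, ← sub_eq_add_neg]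
    simp only [Matrix.mulVec_mulVec]
  · refine ⟨fun t => Ms t * P, hq, fun t ht ω => ?_⟩
    rw [hy t ht ω, Matrix.add_mulVec]
    simp only [Matrix.mulVec_mulVec]

/-- Makes the Hoeffding exponent at deviation `0.1 rζ L` at least `10 log n`. The requirement is
`2560 ≤ 35200`, the latter being `32 / 0.01 ^ 2 * 11 * 0.1 ^ 2`. -/
theorem ten_mul_log_le_of_alphaZero_le {n r : ℕ} {α η ζ q f L : ℝ} (hn : 0 < n) (hr : 0 < r)
    (hη : 0 < η) (hζ : 0 < ζ) (hf : 0 < f) (hL : 0 < L) (hα : alphaZero n r η ζ q f ≤ α) :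
    10 * Real.log n ≤ α * (0.1 * (r * ζ) * L) ^ 2 / (256 * (r * η * (f * L)) ^ 2) := by
  have hr' : (0 : ℝ) < r := Nat.cast_pos.2 hr
  have hlog : 0 ≤ Real.log n := Real.log_nonneg (by exact_mod_cast hn)
  have h1 : (32 / 0.01 ^ 2) * η ^ 2 * ((r : ℝ) ^ 2 * 11 * Real.log n / ((r : ℝ) * ζ) ^ 2) * f ^ 2 ≤
      α := by
    refine le_trans ?_ hα
    rw [alphaZero]
    gcongr
    exact (le_max_left _ _).trans (le_max_left _ _)
  rw [le_div_iff₀ (by positivity)]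
  calc 10 * Real.log n * (256 * (r * η * (f * L)) ^ 2)
      ≤ 35200 * Real.log n * (r * η * (f * L)) ^ 2 := by
        nlinarith [mul_nonneg hlog (sq_nonneg (r * η * (f * L)))]
    _ = (32 / 0.01 ^ 2) * η ^ 2 * ((r : ℝ) ^ 2 * 11 * Real.log n / ((r : ℝ) * ζ) ^ 2) * f ^ 2 *
        (0.1 * (r * ζ) * L) ^ 2 := by field_simp; norm_num; ring
    _ ≤ _ := by gcongr

/-- The first entry of the minimum gives `(q f) ^ 2 b ≤ (rζ) ^ 2 / (4 * 4.1)`, and `16.4 > 16`. -/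
theorem mul_sqrt_mul_le_of_le_betaBound {r : ℕ} {ζ q f b : ℝ} (hq : 0 ≤ q) (hf : 0 < f)
    (hb : 0 ≤ b) (h0 : 0 ≤ r * ζ) (h1 : r * ζ ≤ 1) (h : 0 < q → b ≤ betaBound r ζ q f) :
    q * √b * f ≤ r * ζ / 4 := by
  rcases hq.eq_or_lt with rfl | hq
  · simp; linarith
  have hb' : b ≤ 1 / 4 * ((r * ζ) ^ 2 / (4.1 * (q * f) ^ 2)) := by
    refine (h hq).trans ?_
    rw [betaBound]
    have : ((1 - (r : ℝ) * ζ) / 2) ^ 2 ≤ 1 / 4 := by nlinarith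
    gcongr
    exact min_le_left _ _
  refine (abs_le_of_sq_le_sq' ?_ (by positivity)).2
  rw [mul_pow, mul_pow, Real.sq_sqrt hb]
  calc q ^ 2 * b * f ^ 2 ≤ q ^ 2 * (1 / 4 * ((r * ζ) ^ 2 / (4.1 * (q * f) ^ 2))) * f ^ 2 := by
        gcongr
    _ = (r * ζ) ^ 2 / 16.4 := by field_simp; norm_num; ring
    _ ≤ _ := by
        rw [div_pow]
        exact div_le_div_of_nonneg_left (sq_nonneg _) (by norm_num) (by norm_num)

end CorrPCA

theorem corollary1 {Ω : Type*} [MeasurableSpace Ω] (μ : Measure Ω) [IsProbabilityMeasure μ]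
    (n r α : ℕ) (hr : 0 < r)
    (P : Matrix (Fin n) (Fin r) ℝ) (hP : CorrPCA.IsBasisMatrix P)
    (a : ℕ → Ω → Fin r → ℝ) (lam : Fin r → ℝ) (η : ℝ)
    (ha : CorrPCA.CoeffModel μ α a lam η)
    (T : ℕ → Finset (Fin n)) (y : ℕ → Ω → Fin n → ℝ)
    (q : ℝ) (hq1 : q < 1)
    -- PCA-missing or PCA-SDDC, with the corresponding bound by `q`
    (hmodel :
      (CorrPCA.IsPCAMissing α P a T y ∧
        ∀ t ∈ Finset.Icc 1 α, ‖(CorrPCA.idCols (T t))ᵀ * P‖ ≤ q) ∨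
      (∃ Ms : (t : ℕ) → Matrix (T t) (Fin n) ℝ, CorrPCA.IsPCASDDC α P a T Ms y ∧
        ∀ t ∈ Finset.Icc 1 α, ‖Ms t * P‖ ≤ q))
    (ζ : ℝ) (hζ : 0 < ζ) (hrζ : (r : ℝ) * ζ ≤ 0.01)
    (hα : CorrPCA.alphaZero n r η ζ q (CorrPCA.condNum lam) ≤ α)
    -- the support change model, with `β` small enough (no constraint on `β / α` when `q = 0`)
    (l s ρ : ℕ) (τ : ℕ → ℕ) (S : ℕ → Finset (Fin n)) (βt β : ℝ)
    (hT : CorrPCA.SupportChange α T l τ S s ρ βt β)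
    (hβ : 0 < q → β / α ≤ CorrPCA.betaBound r ζ q (CorrPCA.condNum lam))
    -- the output of simple EVD with threshold `0.95 λ⁻`
    (m : Ω → ℕ) (Phat : (ω : Ω) → Matrix (Fin n) (Fin (m ω)) ℝ)
    (hPhat : ∀ ω, CorrPCA.IsSimpleEVD (CorrPCA.empCov α (fun t => y t ω))
      (0.95 * CorrPCA.lamMin lam) (Phat ω)) :
    1 - 6 * (n : ℝ) ^ (-10 : ℤ) ≤
      μ.real {ω | CorrPCA.subspaceError (Phat ω) P ≤ (r : ℝ) * ζ} := by
  open CorrPCA in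
  have hn : 0 < n := by
    rcases Nat.eq_zero_or_pos n with rfl | hn
    · have := congrFun (congrFun (hP : Pᵀ * P = 1) ⟨0, hr⟩) ⟨0, hr⟩
      simp [Matrix.mul_apply] at this
    · exact hn
  have hr' : (0 : ℝ) < r := Nat.cast_pos.2 hr
  have hcard := hT.card_times_mem_le
  have hβ0 : 0 ≤ β := (Nat.cast_nonneg _).trans (hcard ⟨0, hn⟩)
  have hα' : (0 : ℝ) < α := hβ0.trans_lt hT.beta_lt
  have hα0 : 0 < α := Nat.cast_pos.1 hα'
  obtain ⟨C, hC, hy⟩ := exists_sparse_perturbation hmodel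
  have hq0 : 0 ≤ q := (norm_nonneg _).trans (hC 1 (Finset.mem_Icc.2 ⟨le_rfl, hα0⟩))
  have hη : 0 < η := zero_lt_one.trans_le (ha.one_le_eta hα0 hr)
  set L := lamMin lam
  set f := condNum lam
  have hL : 0 < L := lamMin_pos hr ha.lam_pos
  have hf : 1 ≤ f := one_le_condNum hr ha.lam_pos
  have hlamM : ∀ j, lam j ≤ f * L := fun j => by
    rw [← lamMax_eq hr ha.lam_pos]; exact le_lamMax j
  set x := (r : ℝ) * ζ with hx
  have hx0 : 0 < x := mul_pos hr' hζ
  set N : ℕ → Matrix (Fin n) (Fin r) ℝ := fun t => P + idCols (T t) * C t with hN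
  set g := q * √(β / α) with hg
  have hg0 : 0 ≤ g := by positivity
  have hgf : g * f ≤ x / 4 :=
    mul_sqrt_mul_le_of_le_betaBound hq0 (by linarith) (by positivity) hx0.le (by linarith) hβ
  have hbias : ‖(1 / (α : ℝ)) • ∑ t ∈ Finset.Icc 1 α, N t * Matrix.diagonal lam * (N t)ᵀ -
      P * Matrix.diagonal lam * Pᵀ‖ ≤ (2 * g + g ^ 2) * (f * L) := by
    refine norm_average_sub_le hP hα0 (by positivity)
      (fun j => by rw [abs_of_pos (ha.lam_pos j)]; exact hlamM j) hg0 fun z => ?_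
    refine (sum_norm_sq_idCols_mul_le hC hcard z).trans (le_of_eq ?_)
    rw [hg, mul_pow, Real.sq_sqrt (by positivity)]
    field_simp
  -- `2 g f ≤ x / 2`, and `g ^ 2 f` is negligible because `f ≥ 1` and `x ≤ 0.01` force `g ≤ 0.0025`.
  have hbias' : (2 * g + g ^ 2) * (f * L) ≤ 0.51 * x * L := by
    have h1 : g ≤ 0.0025 := by nlinarith
    have h2 : (2 * g + g ^ 2) * f ≤ 0.51 * x := by nlinarith
    nlinarith
  have htail := ha.measureReal_norm_empCov_sub_ge_le hα0 hr hlamM (N := N)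
    (fun t ht => (norm_add_le _ _).trans
      (by linarith [hP.opNorm_le_one, norm_idCols_mul_le (hC t ht)])) hy
    (ε := 0.1 * x * L) (by positivity)
  have hexp := ten_mul_log_le_of_alphaZero_le hn hr hη hζ (by linarith) hL hα
  have hpow : Real.exp (-(10 * Real.log n)) = (n : ℝ) ^ (-10 : ℤ) := by
    rw [← neg_mul, mul_comm, Real.exp_mul, Real.exp_log (Nat.cast_pos.2 hn), ← Real.rpow_intCast]
    norm_num
  have htail' := htail.trans (mul_le_mul_of_nonneg_left
    (Real.exp_le_exp.2 (neg_le_neg hexp)) zero_le_two)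
  rw [hpow] at htail'
  set bad := {ω | 0.1 * x * L ≤ ‖empCov α (fun t => y t ω) -
    (1 / (α : ℝ)) • ∑ t ∈ Finset.Icc 1 α, N t * Matrix.diagonal lam * (N t)ᵀ‖}
  -- `Phat` is not assumed measurable in `ω`, so the good event may not be either; subadditivity
  -- over a cover replaces passing to complements.
  have hcover : Set.univ ⊆ {ω | subspaceError (Phat ω) P ≤ x} ∪ bad := by
    intro ω _
    by_cases hω : ω ∈ bad
    · exact Or.inr hω
    refine Or.inl ?_
    have hω' : ‖empCov α (fun t => y t ω) -
        (1 / (α : ℝ)) • ∑ t ∈ Finset.Icc 1 α, N t * Matrix.diagonal lam * (N t)ᵀ‖ <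
        0.1 * x * L := not_le.1 hω
    have hH := (norm_add_le _ _).trans (add_le_add hω'.le (hbias.trans hbias'))
    rw [sub_add_sub_cancel] at hH
    -- `0.61` adds the bias `0.51` to the fluctuation `0.1`, and `3 / 2 * 0.61 = 0.915`.
    have := subspaceError_le (δ := 0.61 * x) hP (isHermitian_empCov α fun t => y t ω)
      (add_sub_cancel _ _).symm hL lamMin_le (by linarith) (hH.trans (by linarith)) (hPhat ω)
    rw [Set.mem_ofPred_eq]
    linarith
  have h1 := (measureReal_mono (μ := μ) hcover).trans (measureReal_union_le _ _)
  rw [probReal_univ] at h1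
  have h2 : (0 : ℝ) ≤ (n : ℝ) ^ (-10 : ℤ) := by positivity
  linarith
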